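/- **Setting.** Let $\mathcal A$ be a finite set of $m\ge 4$ alternatives. A profile of $n$ agents is an $n$-tuple $\mathcal P$ of votes, a vote being a linear order of $\mathcal A$; its voting situation is the multiset of its votes. Under the Impartial Anonymous Culture (IAC) all voting situations with $n$ votes are equally likely (and, given the voting situation, all profiles with that situation are equally likely). For a profile let $n_{xy}$ be the number of agents ranking $x$ above $y$, and $\mathrm{adv}(x,y)=\max(0,n_{xy}-n_{yx})$. An alternative $a$ is a Condorcet-tie winner if $\mathrm{adv}(b,a)=0$ for all $b\ne a$. Consider the following scores of an alternative $a$; the winners of each rule are the alternatives with the lowest score. * *Dodgson*: the minimum number of swaps of neighbouring alternatives in votes that makes $a$ a Condorcet-tie winner. * *Tideman*: $\sum_{b\neq a}\mathrm{adv}(b,a)$. * *Dodgson Quick (DQ)*: $\sum_{b\ne a}\lceil \mathrm{adv}(b,a)/2\rceil$. * *Greedy*: $\sum_{b\ne a}\bigl(N(b,a)+p\cdot[\,s(b,a)<N(b,a)\,]\bigr)$. Here $[\cdot]$ is $1$ if the condition holds and $0$ otherwise, $s(b,a)$ is the number of agents ranking $b$ immediately above $a$, and $N(b,a)$ is the number of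 votes in which $a$ must be moved from below to above $b$. If $a$ is required to tie or defeat $b$, then $N(b,a)=\lceil \mathrm{adv}(b,a)/2\rceil$. If $a$ is required to defeat $b$, then $N(b,a)=\lfloor (n_{ba}-n_{ab})/2\rfloor+1$ when $n_{ba}\ge n_{ab}$ and $N(b,a)=0$ otherwise. The theorem holds for both of these conventions and for every fixed integer $p\ge 0$ (an additive penalty when there are too few votes in which a single swap suffices). **Theorem.** Let $m\ge 4$ and let $X$ be any of the DQ, Tideman and Greedy rules. Under IAC the $X$ winners do not converge to the Dodgson winners: the probability that $X$ and Dodgson's rule pick the same winners does not tend to $1$ as $n\to\infty$. Moreover, there is $\varepsilon>0$ such that for all sufficiently large $n$, the probability under IAC that no alternative is both an $X$ winner and a Dodgson winner is at least $\varepsilon$. -/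

import Mathlib

namespace Election

/-- A vote: a linear order of the alternatives, given as the ranking that sends every alternative
to its position (position `0` is the top). -/
abbrev Vote (A : Type*) [Fintype A] : Type _ := A ≃ Fin (Fintype.card A)

/-- A profile: one vote for each of the `n` agents. -/
abbrev Profile (A : Type*) [Fintype A] (n : ℕ) : Type _ := Fin n → Vote A

/-- A score-based rule: a score for every alternative in every profile, for any number of agents. -/
abbrev ScoreRule (A : Type*) [Fintype A] : Type _ := ∀ n : ℕ, Profile A n → A → ℕ

section Scores

variable {A : Type*} [Fintype A] {n : ℕ}

/-- `P.prefCount x y` is `n_{xy}`, the number of agents who rank `x` above `y`. -/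
def prefCount (P : Profile A n) (x y : A) : ℕ :=
  (Finset.univ.filter fun i : Fin n => P i x < P i y).card

/-- `adv(x, y) = max(0, n_{xy} - n_{yx})` (natural-number subtraction truncates at `0`). -/
def adv (P : Profile A n) (x y : A) : ℕ := prefCount P x y - prefCount P y x

/-- `a` is a Condorcet-tie winner: no other alternative has a positive advantage over `a`. -/
def IsCondorcetTieWinner (P : Profile A n) (a : A) : Prop := ∀ b, b ≠ a → adv P b a = 0

/-- The vote `v` with the alternatives at the neighbouring positions `k` and `k + 1` exchanged. -/
def neighbourSwap (v : Vote A) (k : ℕ) (hk : k + 1 < Fintype.card A) : Vote A :=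
  v.trans (Equiv.swap ⟨k, Nat.lt_of_succ_lt hk⟩ ⟨k + 1, hk⟩)

/-- `SwapsTo k P Q`: the profile `Q` is reached from `P` by `k` successive swaps, each of two
neighbouring alternatives in the vote of one agent. -/
inductive SwapsTo : ℕ → Profile A n → Profile A n → Prop
  | zero (P : Profile A n) : SwapsTo 0 P P
  | succ {t : ℕ} {P Q : Profile A n} (i : Fin n) (k : ℕ) (hk : k + 1 < Fintype.card A)
      (h : SwapsTo t P Q) :
      SwapsTo (t + 1) P (Function.update Q i (neighbourSwap (Q i) k hk))

/-- The Dodgson score: the minimum number of swaps of neighbouring alternatives that make `a`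
a Condorcet-tie winner. -/
noncomputable def dodgsonScore : ScoreRule A := fun _ P a =>
  sInf {t : ℕ | ∃ Q, SwapsTo t P Q ∧ IsCondorcetTieWinner Q a}

variable [DecidableEq A]

/-- The Tideman score `∑_{b ≠ a} adv(b, a)`. -/
def tidemanScore : ScoreRule A := fun _ P a => ∑ b ∈ Finset.univ.erase a, adv P b a

/-- The Dodgson Quick score `∑_{b ≠ a} ⌈adv(b, a) / 2⌉`. -/
def dqScore : ScoreRule A := fun _ P a => ∑ b ∈ Finset.univ.erase a, adv P b a ⌈/⌉ 2

/-- The number of agents who rank `b` immediately above `a`. -/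
def swapCount (P : Profile A n) (b a : A) : ℕ :=
  (Finset.univ.filter fun i : Fin n => (P i b : ℕ) + 1 = (P i a : ℕ)).card

/-- The number of votes in which `a` has to be moved from below `b` to above `b` in order to tie
or defeat `b` (`strict = false`), or to defeat `b` (`strict = true`). In the strict case this is
`⌊Deficit / 2⌋ + 1` if `Deficit = n_{ba} - n_{ab}` is nonnegative, and `0` otherwise. -/
def greedyNeed (strict : Bool) (P : Profile A n) (b a : A) : ℕ :=
  if strict then
    if prefCount P a b ≤ prefCount P b a then adv P b a / 2 + 1 else 0
  else adv P b a ⌈/⌉ 2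

/-- The score returned by the greedy algorithm: for each opponent `b` of `a` it adds the number
of votes needed against `b`, plus `p` if `b` is immediately above `a` in fewer votes than that
(the situation in which the algorithm's answer is only a "maybe"). -/
def greedyScore (strict : Bool) (p : ℕ) : ScoreRule A := fun _ P a =>
  ∑ b ∈ Finset.univ.erase a,
    (greedyNeed strict P b a + if swapCount P b a < greedyNeed strict P b a then p else 0)

end Scores

section Distribution

variable (A : Type*) [Fintype A]

/-- The winners of a score-based rule: the alternatives with the lowest score. -/
def winners {A : Type*} [Fintype A] (R : ScoreRule A) {n : ℕ} (P : Profile A n) : Set A :=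
  {a | ∀ b, R n P a ≤ R n P b}

/-- The voting situation of a profile: the multiset of its votes. -/
def situation {A : Type*} [Fintype A] {n : ℕ} (P : Profile A n) : Sym (Vote A) n :=
  ⟨Finset.univ.val.map P, by simp⟩

theorem situation_surjective {A : Type*} [Fintype A] {n : ℕ} (U : Sym (Vote A) n) :
    ∃ P : Profile A n, situation P = U := by
  obtain ⟨s, hs⟩ := U
  induction s using Quotient.inductionOn with
  | h l =>
    have hl : l.length = n := by simpa using hs
    subst hl
    refine ⟨l.get, Subtype.ext ?_⟩
    simp [situation]

instance instNonemptyVote : Nonempty (Vote A) := ⟨Fintype.equivFin A⟩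

instance instNonemptySituation (n : ℕ) : Nonempty (Sym (Vote A) n) :=
  ⟨Sym.replicate n (Fintype.equivFin A)⟩

variable [DecidableEq A]

/-- The Impartial Anonymous Culture as a distribution of profiles of `n` agents: all voting
situations are equally likely, and so are all profiles with the same voting situation. -/
noncomputable def iac (n : ℕ) : PMF (Profile A n) :=
  (PMF.uniformOfFintype (Sym (Vote A) n)).bind fun U =>
    PMF.uniformOfFinset (Finset.univ.filter fun P : Profile A n => situation P = U)
      (by obtain ⟨P, hP⟩ := situation_surjective U; exact ⟨P, by simp [hP]⟩)

variable {A}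

/-- The probability of a set of profiles of `n` agents under the Impartial Anonymous Culture. -/
noncomputable def iacProb (n : ℕ) (E : Set (Profile A n)) : ENNReal :=
  (iac A n).toOuterMeasure E

/-- Two rules converge to each other under the Impartial Anonymous Culture: the probability that
they pick the same winners tends to `1` as the number of agents tends to infinity. -/
def ConvergeUnderIAC (R S : ScoreRule A) : Prop :=
  Filter.Tendsto (fun n => iacProb n {P : Profile A n | winners R P = winners S P})
    Filter.atTop (nhds 1)

end Distribution

end Election

/-! Each of the rules `R` is, up to halving, the Tideman score with a bounded error, so an
alternative whose Tideman score is lowest by a margin linear in `n` is the only `R` winner.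
Dodgson's score also depends on where the opponents stand. Take `q` copies of a 20-vote pattern. The
alternative `a` loses only to `x`, by `4q`, but `x` is never immediately above `a`, so each of the
`2q` votes to be turned costs two swaps. The alternative `x` loses only to `y`, by `6q`, and `y` is
immediately above `x` in `8q` votes, so `3q` single swaps suffice. Hence `a` is the only `R` winner,
while `x` beats it under Dodgson (`SeparatingVotes.disjoint_winners`).

The gaps are linear in `q`, so they survive `k` arbitrary further votes when `k` is a small fraction
of `q`. The number of situations with `j` votes is a polynomial in `j` of fixed degree, so with `k`
proportional to `n` such situations keep a positive share under IAC (`inv_pow_le_iacProb`). -/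

namespace Election

/-! ### Swaps and bounds for the Dodgson score -/

section Scores

variable {A : Type*} [Fintype A] {n : ℕ}

theorem prefCount_add_prefCount (P : Profile A n) {x y : A} (h : x ≠ y) :
    prefCount P x y + prefCount P y x = n := by
  unfold prefCount
  have := Finset.card_filter_add_card_filter_not (s := (Finset.univ : Finset (Fin n)))
    (fun i => P i x < P i y)
  rw [Finset.card_univ, Fintype.card_fin] at this
  refine Eq.trans ?_ this
  congr 2
  ext i
  have hne : P i x ≠ P i y := fun e => h ((P i).injective e)
  simp only [Finset.mem_filter, Finset.mem_univ, true_and, not_lt]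
  exact ⟨le_of_lt, fun hl => lt_of_le_of_ne hl hne.symm⟩

theorem SwapsTo.trans {s t : ℕ} {P Q R : Profile A n} (h : SwapsTo s P Q) (h' : SwapsTo t Q R) :
    SwapsTo (s + t) P R := by
  induction h' with
  | zero => exact h
  | succ i k hk _ ih => exact SwapsTo.succ i k hk (ih h)

theorem exists_swapsTo_top (a : A) (N : ℕ) :
    ∀ P : Profile A n, ∑ i, (P i a : ℕ) = N →
      ∃ t Q, SwapsTo t P Q ∧ ∀ i, (Q i a : ℕ) = 0 := by
  induction N with
  | zero =>
    intro P hP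
    exact ⟨0, P, SwapsTo.zero P, fun i => (Finset.sum_eq_zero_iff.1 hP) i (Finset.mem_univ i)⟩
  | succ N ih =>
    intro P hP
    obtain ⟨i, -, hi⟩ := Finset.exists_ne_zero_of_sum_ne_zero
      (s := Finset.univ) (f := fun i => (P i a : ℕ)) (by omega)
    obtain ⟨k, hk⟩ := Nat.exists_eq_succ_of_ne_zero hi
    have hlt : k + 1 < Fintype.card A := by have := (P i a).2; omega
    have hs : SwapsTo (0 + 1) P (Function.update P i (neighbourSwap (P i) k hlt)) :=
      SwapsTo.succ i k hlt (SwapsTo.zero P)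
    have hpos : P i a = ⟨k + 1, hlt⟩ := Fin.ext hk
    have hnew : (neighbourSwap (P i) k hlt a : ℕ) = k := by
      simp [neighbourSwap, hpos]
    obtain ⟨t, Q, hQ, hQ0⟩ := ih (Function.update P i (neighbourSwap (P i) k hlt)) (by
      rw [← Finset.add_sum_erase _ _ (Finset.mem_univ i)] at hP ⊢
      rw [Function.update_self, hnew]
      have : ∑ j ∈ Finset.univ.erase i,
          (Function.update P i (neighbourSwap (P i) k hlt) j a : ℕ)
          = ∑ j ∈ Finset.univ.erase i, (P j a : ℕ) :=
        Finset.sum_congr rfl fun j hj => by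
          rw [Function.update_of_ne (Finset.ne_of_mem_erase hj)]
      omega)
    exact ⟨_, Q, hs.trans hQ, hQ0⟩

/-- Every alternative can be made a Condorcet-tie winner. -/
theorem exists_swapsTo_isCondorcetTieWinner (P : Profile A n) (a : A) :
    ∃ t Q, SwapsTo t P Q ∧ IsCondorcetTieWinner Q a := by
  obtain ⟨t, Q, h, h0⟩ := exists_swapsTo_top a _ P rfl
  refine ⟨t, Q, h, fun b _ => ?_⟩
  have : prefCount Q b a = 0 := by
    simp only [prefCount, Finset.card_eq_zero, Finset.filter_eq_empty_iff, Finset.mem_univ,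
      true_implies, not_lt, Fin.le_def]
    intro i
    rw [h0 i]
    exact Nat.zero_le _
  simp [adv, this]

/-- The truncated depth of `a` below `x`, capped at 2, serves as a potential. It vanishes when `a`
is above `x`, and a swap lowers it by at most 1: when `a` and `x` are themselves exchanged it was
only 1 before. -/
theorem min_two_sub_le_neighbourSwap (v : Vote A) (k : ℕ) (hk : k + 1 < Fintype.card A)
    (x a : A) :
    min 2 ((v a : ℕ) - v x) ≤
      min 2 ((neighbourSwap v k hk a : ℕ) - neighbourSwap v k hk x) + 1 := by
  simp only [neighbourSwap, Equiv.trans_apply, Equiv.swap_apply_def, Fin.ext_iff]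
  split_ifs <;> (try dsimp only) <;> omega

theorem SwapsTo.sum_min_two_sub_le {t : ℕ} {P Q : Profile A n} (h : SwapsTo t P Q) (x a : A) :
    ∑ i, min 2 ((P i a : ℕ) - P i x) ≤ ∑ i, min 2 ((Q i a : ℕ) - Q i x) + t := by
  induction h with
  | zero => simp
  | @succ t P Q i k hk _ ih =>
    rw [← Finset.add_sum_erase _ _ (Finset.mem_univ i)] at ih ⊢
    rw [← Finset.add_sum_erase _ (fun j => min 2 ((Q j a : ℕ) - Q j x)) (Finset.mem_univ i)] at ih
    rw [← Finset.add_sum_erase _ (fun j => min 2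
      ((Function.update Q i (neighbourSwap (Q i) k hk) j a : ℕ) -
        Function.update Q i (neighbourSwap (Q i) k hk) j x)) (Finset.mem_univ i)]
    have : ∑ j ∈ Finset.univ.erase i, min 2
          ((Function.update Q i (neighbourSwap (Q i) k hk) j a : ℕ) -
            Function.update Q i (neighbourSwap (Q i) k hk) j x)
        = ∑ j ∈ Finset.univ.erase i, min 2 ((Q j a : ℕ) - Q j x) :=
      Finset.sum_congr rfl fun j hj => by
        rw [Function.update_of_ne (Finset.ne_of_mem_erase hj)]
    rw [this, Function.update_self]
    have := min_two_sub_le_neighbourSwap (Q i) k hk x a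
    omega

/-- If `c` agents rank `x` at least two positions above `a`, then the Dodgson score of `a` is at
least `2 * c - n`. -/
theorem two_mul_card_le_dodgsonScore_add (P : Profile A n) {x a : A} (h : x ≠ a) :
    2 * (Finset.univ.filter fun i => (P i x : ℕ) + 2 ≤ P i a).card ≤ dodgsonScore n P a + n := by
  -- Attainability is essential for a lower bound, since `sInf ∅ = 0`.
  obtain ⟨Q, hQ, hw⟩ : ∃ Q, SwapsTo (dodgsonScore n P a) P Q ∧ IsCondorcetTieWinner Q a :=
    Nat.sInf_mem (s := {t : ℕ | ∃ Q, SwapsTo t P Q ∧ IsCondorcetTieWinner Q a})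
      (exists_swapsTo_isCondorcetTieWinner P a)
  have h1 := hQ.sum_min_two_sub_le x a
  have h2 : 2 * (Finset.univ.filter fun i => (P i x : ℕ) + 2 ≤ P i a).card
      ≤ ∑ i, min 2 ((P i a : ℕ) - P i x) := by
    rw [Finset.card_filter, Finset.mul_sum]
    refine Finset.sum_le_sum fun i _ => ?_
    split_ifs <;> omega
  have h3 : ∑ i, min 2 ((Q i a : ℕ) - Q i x) ≤ 2 * prefCount Q x a := by
    rw [prefCount, Finset.card_filter, Finset.mul_sum]
    refine Finset.sum_le_sum fun i _ => ?_
    simp only [Fin.lt_def]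
    split_ifs <;> omega
  -- In `Q` at most half of the agents rank `x` above `a`, so the final potential is at most `n`.
  have h4 := prefCount_add_prefCount Q h
  have h5 := hw x h
  rw [adv] at h5
  omega

theorem isCondorcetTieWinner_of_le {P : Profile A n} {a : A}
    (h : ∀ b, b ≠ a → n ≤ 2 * prefCount P a b) : IsCondorcetTieWinner P a := by
  intro b hb
  have := prefCount_add_prefCount P hb
  have := h b hb
  rw [adv]
  omega

/-- The same neighbouring swap may be made in the votes of any set of agents. -/
theorem swapsTo_neighbourSwap (P : Profile A n) (S : Finset (Fin n)) (k : ℕ)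
    (hk : k + 1 < Fintype.card A) :
    SwapsTo S.card P (fun i => if i ∈ S then neighbourSwap (P i) k hk else P i) := by
  induction S using Finset.induction_on with
  | empty => simpa using SwapsTo.zero P
  | insert i S hi ih =>
    rw [Finset.card_insert_of_notMem hi]
    convert SwapsTo.succ i k hk ih using 1
    funext j
    rcases eq_or_ne j i with rfl | hj
    · simp [hi]
    · simp [hj]

/-- If in the common vote of `c` agents `y` is immediately above `x`, and raising `x` above `y` in
`s ≤ c` of these votes is enough for a tie with `y`, then the Dodgson score of `x` is at most
`s`, provided that `x` ties all its other opponents. -/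
theorem dodgsonScore_le (P : Profile A n) {x y : A} (v : Vote A) (hv : (v y : ℕ) + 1 = v x)
    (s : ℕ) (hs : s ≤ (Finset.univ.filter fun i => P i = v).card)
    (hy : n ≤ 2 * (prefCount P x y + s))
    (hw : ∀ w, w ≠ x → w ≠ y → n ≤ 2 * prefCount P x w) : dodgsonScore n P x ≤ s := by
  obtain ⟨S, hS, rfl⟩ := Finset.exists_subset_card_eq hs
  have hSv : ∀ i ∈ S, P i = v := fun i hi => (Finset.mem_filter.1 (hS hi)).2
  have hk : (v y : ℕ) + 1 < Fintype.card A := hv ▸ (v x).2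
  have hx : v x = ⟨(v y : ℕ) + 1, hk⟩ := Fin.ext hv.symm
  refine Nat.sInf_le ⟨_, swapsTo_neighbourSwap P S (v y) hk, isCondorcetTieWinner_of_le ?_⟩
  have hnx : (neighbourSwap v (v y) hk x : ℕ) = v y := by
    simp [neighbourSwap, hx]
  have hny : (neighbourSwap v (v y) hk y : ℕ) = v x := by
    simp [neighbourSwap, hx]
  intro w hwx
  rcases eq_or_ne w y with rfl | hwy
  · refine hy.trans (Nat.mul_le_mul_left 2 ?_)
    -- The votes in `S` had `w` above `x`, so all of them are new support for `x`.
    have hd : Disjoint (Finset.univ.filter fun i => P i x < P i w) S := by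
      rw [Finset.disjoint_left]
      intro i hi hiS
      have := (Finset.mem_filter.1 hi).2
      rw [hSv i hiS, Fin.lt_def] at this
      omega
    rw [prefCount, prefCount, ← Finset.card_union_of_disjoint hd]
    refine Finset.card_le_card fun i hi => ?_
    simp only [Finset.mem_filter, Finset.mem_univ, true_and]
    by_cases hiS : i ∈ S
    · rw [if_pos hiS, hSv i hiS, Fin.lt_def]
      omega
    · rw [if_neg hiS]
      simpa [hiS] using hi
  · refine (hw w hwx hwy).trans (Nat.mul_le_mul_left 2 (Finset.card_le_card fun i hi => ?_))
    simp only [Finset.mem_filter, Finset.mem_univ, true_and] at hi ⊢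
    by_cases hiS : i ∈ S
    · have hne : (v w : ℕ) ≠ v y := fun e => hwy (v.injective (Fin.ext e))
      have hne' : (v w : ℕ) ≠ v x := fun e => hwx (v.injective (Fin.ext e))
      have hnw : (neighbourSwap v (v y) hk w : ℕ) = v w := by
        rw [neighbourSwap, Equiv.trans_apply, Equiv.swap_apply_of_ne_of_ne]
        · exact fun e => hne (by simp [e])
        · exact fun e => hne' (by rw [e, hx])
      rw [hSv i hiS, Fin.lt_def] at hi
      rw [if_pos hiS, hSv i hiS, Fin.lt_def]
      omega
    · rwa [if_neg hiS]

theorem winners_nonempty [Nonempty A] (R : ScoreRule A) (P : Profile A n) :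
    (winners R P).Nonempty := by
  obtain ⟨a, ha⟩ := Finite.exists_min (R n P)
  exact ⟨a, ha⟩

theorem countP_situation (P : Profile A n) (p : Vote A → Prop) [DecidablePred p] :
    (situation P : Multiset (Vote A)).countP p = (Finset.univ.filter fun i => p (P i)).card := by
  change (Finset.univ.val.map P).countP p = _
  rw [Multiset.countP_map]
  rfl

end Scores

/-! ### Rules within a constant of Tideman's -/

section RuleBounds

variable {A : Type*} [Fintype A] [DecidableEq A]

/-- `R` prefers `a` to `b` whenever the Tideman score does so by more than a constant. -/
def FollowsTideman (R : ScoreRule A) : Prop :=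
  ∃ C : ℕ, ∀ (n : ℕ) (P : Profile A n) (a b : A),
    tidemanScore n P a + C < tidemanScore n P b → R n P a < R n P b

theorem followsTideman_of_le (R : ScoreRule A) (c : ℕ)
    (h₁ : ∀ n (P : Profile A n) a, tidemanScore n P a ≤ 2 * R n P a)
    (h₂ : ∀ n (P : Profile A n) a, 2 * R n P a ≤ tidemanScore n P a + c) : FollowsTideman R := by
  refine ⟨c, fun n P a b h => ?_⟩
  have := h₁ n P b
  have := h₂ n P a
  omega

theorem followsTideman_of_sum (R : ScoreRule A) (f : ∀ n : ℕ, Profile A n → A → A → ℕ) (c : ℕ)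
    (hR : ∀ n P a, R n P a = ∑ b ∈ Finset.univ.erase a, f n P b a)
    (h₁ : ∀ n (P : Profile A n) a b, adv P b a ≤ 2 * f n P b a)
    (h₂ : ∀ n (P : Profile A n) a b, 2 * f n P b a ≤ adv P b a + c) : FollowsTideman R := by
  refine followsTideman_of_le R (Fintype.card A * c) (fun n P a => ?_) (fun n P a => ?_)
  · rw [hR, tidemanScore, Finset.mul_sum]
    exact Finset.sum_le_sum fun b _ => h₁ n P a b
  · rw [hR, tidemanScore, Finset.mul_sum]
    refine (Finset.sum_le_sum fun b _ => h₂ n P a b).trans ?_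
    rw [Finset.sum_add_distrib, Finset.sum_const, smul_eq_mul]
    exact Nat.add_le_add_left (Nat.mul_le_mul_right c (Finset.card_le_univ _)) _

theorem followsTideman_tidemanScore : FollowsTideman (tidemanScore : ScoreRule A) :=
  ⟨0, fun _ _ _ _ h => h⟩

theorem followsTideman_dqScore : FollowsTideman (dqScore : ScoreRule A) :=
  followsTideman_of_sum _ (fun _ P b a => adv P b a ⌈/⌉ 2) 1 (fun _ _ _ => rfl)
    (fun n P a b => by rw [Nat.ceilDiv_eq_add_pred_div]; omega)
    (fun n P a b => by rw [Nat.ceilDiv_eq_add_pred_div]; omega)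

theorem followsTideman_greedyScore (strict : Bool) (p : ℕ) :
    FollowsTideman (greedyScore strict p : ScoreRule A) := by
  -- After doubling, strictness adds at most 2 per opponent and the penalty at most `2 * p`.
  refine followsTideman_of_sum _ (fun _ P b a => greedyNeed strict P b a +
    if swapCount P b a < greedyNeed strict P b a then p else 0) (2 + 2 * p) (fun _ _ _ => rfl)
    (fun n P a b => ?_) (fun n P a b => ?_)
  all_goals
    simp only [greedyNeed, Nat.ceilDiv_eq_add_pred_div, adv]
    split_ifs <;> omega

end RuleBounds

/-! ### The separating votes -/

/-- A multiset of `20` votes in which the Tideman winner `a` loses only to `x`, which is never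
immediately above `a` in these votes, while `x` loses only to `y`, which is immediately above `x`
in sufficiently many votes. -/
structure SeparatingVotes {A : Type*} [Fintype A] [DecidableEq A] (B : Multiset (Vote A))
    (a x y : A) (v : Vote A) : Prop where
  card_eq : B.card = 20
  ne_ax : a ≠ x
  ne_ay : a ≠ y
  ne_xy : x ≠ y
  far : 12 ≤ B.countP fun u => (u x : ℕ) + 2 ≤ u a
  a_x : 8 ≤ B.countP fun u => u a < u x
  a_w : ∀ w, w ≠ a → w ≠ x → 10 ≤ B.countP fun u => u a < u w
  a_y : 13 ≤ B.countP fun u => u a < u y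
  y_x : 13 ≤ B.countP fun u => u y < u x
  x_y : 7 ≤ B.countP fun u => u x < u y
  x_a : 12 ≤ B.countP fun u => u x < u a
  x_w : ∀ w, w ≠ a → w ≠ x → w ≠ y → 20 ≤ B.countP fun u => u x < u w
  near : 8 ≤ B.countP fun u => u = v
  adjacent : (v y : ℕ) + 1 = v x

section Separation

variable {A : Type*} [Fintype A] [DecidableEq A]

theorem exists_separatingVotes (hm : 4 ≤ Fintype.card A) :
    ∃ (B : Multiset (Vote A)) (a x y : A) (v : Vote A), SeparatingVotes B a x y v := by
  obtain ⟨e⟩ : Nonempty (Vote A) := inferInstance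
  let i₀ : Fin (Fintype.card A) := ⟨0, by omega⟩
  let i₁ : Fin (Fintype.card A) := ⟨1, by omega⟩
  let i₂ : Fin (Fintype.card A) := ⟨2, by omega⟩
  let i₃ : Fin (Fintype.card A) := ⟨3, by omega⟩
  -- If `e` begins a, y, x, z, then `v₁` begins x, y, a, z, `v₂` begins x, z, a, y and `v₃` begins
  -- y, x, z, a. The multiplicities of `v₁`, `v₂`, `v₃`, `e` are 2, 5, 5, 8. All later alternatives
  -- stay in place.
  let v₁ : Vote A := e.trans (Equiv.swap i₀ i₂)
  let v₂ : Vote A := (e.trans (Equiv.swap i₀ i₂)).trans (Equiv.swap i₁ i₃)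
  let v₃ : Vote A :=
    ((e.trans (Equiv.swap i₀ i₁)).trans (Equiv.swap i₁ i₂)).trans (Equiv.swap i₂ i₃)
  have hcount : ∀ (p : Vote A → Prop) [DecidablePred p],
      (Multiset.replicate 2 v₁ + Multiset.replicate 5 v₂ + Multiset.replicate 5 v₃ +
        Multiset.replicate 8 e).countP p = (if p v₁ then 2 else 0) + (if p v₂ then 5 else 0) +
          (if p v₃ then 5 else 0) + if p e then 8 else 0 := by
    intro p _
    simp only [Multiset.countP_add, ← Multiset.coe_replicate, Multiset.coe_countP,
      List.countP_replicate, decide_eq_true_eq]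
  have hne : ∀ w i, w ≠ e.symm i → (e w : ℕ) ≠ i := fun w i h h' =>
    h (by rw [← Fin.ext h', Equiv.symm_apply_apply])
  have pos₁ : ∀ w, (v₁ w : ℕ) = if (e w : ℕ) = 0 then (2 : ℕ) else
      if (e w : ℕ) = 2 then (0 : ℕ) else (e w : ℕ) := by
    intro w
    simp only [v₁, i₀, i₂, Equiv.trans_apply, Equiv.swap_apply_def, Fin.ext_iff]
    split_ifs <;> dsimp only at *
  have pos₂ : ∀ w, (v₂ w : ℕ) = if (e w : ℕ) = 0 then (2 : ℕ) else
      if (e w : ℕ) = 2 then (0 : ℕ) else if (e w : ℕ) = 1 then (3 : ℕ) else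
      if (e w : ℕ) = 3 then (1 : ℕ) else (e w : ℕ) := by
    intro w
    simp only [v₂, i₀, i₁, i₂, i₃, Equiv.trans_apply, Equiv.swap_apply_def, Fin.ext_iff]
    split_ifs <;> (try dsimp only at *) <;> omega
  have pos₃ : ∀ w, (v₃ w : ℕ) = if (e w : ℕ) = 0 then (3 : ℕ) else
      if (e w : ℕ) ≤ 3 then (e w : ℕ) - 1 else (e w : ℕ) := by
    intro w
    simp only [v₃, i₀, i₁, i₂, i₃, Equiv.trans_apply, Equiv.swap_apply_def, Fin.ext_iff]
    split_ifs <;> (try dsimp only at *) <;> omega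
  have hlarge₁ : ∀ w, 4 ≤ (e w : ℕ) → (v₁ w : ℕ) = e w := by
    intro w h
    rw [pos₁, if_neg (by omega), if_neg (by omega)]
  have hlarge₂ : ∀ w, 4 ≤ (e w : ℕ) → (v₂ w : ℕ) = e w := by
    intro w h
    rw [pos₂, if_neg (by omega), if_neg (by omega), if_neg (by omega), if_neg (by omega)]
  have hlarge₃ : ∀ w, 4 ≤ (e w : ℕ) → (v₃ w : ℕ) = e w := by
    intro w h
    rw [pos₃, if_neg (by omega), if_neg (by omega)]
  have e₀ : (e (e.symm i₀) : ℕ) = 0 := by simp [i₀]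
  have e₁ : (e (e.symm i₁) : ℕ) = 1 := by simp [i₁]
  have e₂ : (e (e.symm i₂) : ℕ) = 2 := by simp [i₂]
  clear_value v₁ v₂ v₃
  refine ⟨Multiset.replicate 2 v₁ + Multiset.replicate 5 v₂ + Multiset.replicate 5 v₃ +
    Multiset.replicate 8 e, e.symm i₀, e.symm i₂, e.symm i₁, e, ?_⟩
  constructor
  · simp only [Multiset.card_add, Multiset.card_replicate]
  · simp [i₀, i₂]
  · simp [i₀, i₁]
  · simp [i₁, i₂]
  · simp only [hcount, pos₁, pos₂, pos₃, e₀, e₂]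
    norm_num
  · simp only [hcount, Fin.lt_def, pos₁, pos₂, pos₃, e₀, e₂]
    norm_num
  · intro w h₀ h₂
    have h₀ : (e w : ℕ) ≠ 0 := hne w _ h₀
    have h₂ : (e w : ℕ) ≠ 2 := hne w _ h₂
    obtain h | h | h : (e w : ℕ) = 1 ∨ (e w : ℕ) = 3 ∨ 4 ≤ (e w : ℕ) := by omega
    · simp only [hcount, Fin.lt_def, pos₁, pos₂, pos₃, e₀, h]
      norm_num
    · simp only [hcount, Fin.lt_def, pos₁, pos₂, pos₃, e₀, h]
      norm_num
    · rw [hcount, if_pos (by rw [Fin.lt_def, hlarge₁ w h, pos₁, e₀]; simp; omega),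
        if_pos (by rw [Fin.lt_def, hlarge₂ w h, pos₂, e₀]; simp; omega),
        if_pos (by rw [Fin.lt_def, hlarge₃ w h, pos₃, e₀]; simp; omega)]
      omega
  · simp only [hcount, Fin.lt_def, pos₁, pos₂, pos₃, e₀, e₁]
    norm_num
  · simp only [hcount, Fin.lt_def, pos₁, pos₂, pos₃, e₁, e₂]
    norm_num
  · simp only [hcount, Fin.lt_def, pos₁, pos₂, pos₃, e₁, e₂]
    norm_num
  · simp only [hcount, Fin.lt_def, pos₁, pos₂, pos₃, e₀, e₂]
    norm_num
  · intro w h₀ h₂ h₁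
    have h₀ : (e w : ℕ) ≠ 0 := hne w _ h₀
    have h₁ : (e w : ℕ) ≠ 1 := hne w _ h₁
    have h₂ : (e w : ℕ) ≠ 2 := hne w _ h₂
    obtain h | h : (e w : ℕ) = 3 ∨ 4 ≤ (e w : ℕ) := by omega
    · simp only [hcount, Fin.lt_def, pos₁, pos₂, pos₃, e₂, h]
      norm_num
    · rw [hcount, if_pos (by rw [Fin.lt_def, hlarge₁ w h, pos₁, e₂]; simp; omega),
        if_pos (by rw [Fin.lt_def, hlarge₂ w h, pos₂, e₂]; simp; omega),
        if_pos (by rw [Fin.lt_def, hlarge₃ w h, pos₃, e₂]; simp; omega),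
        if_pos (by rw [Fin.lt_def, e₂]; omega)]
  · rw [hcount, if_pos (rfl : e = e)]
    omega
  · rw [e₁, e₂]

/-- A profile that contains `q` copies of separating votes and relatively few other votes has
disjoint sets of winners. -/
theorem SeparatingVotes.disjoint_winners {B : Multiset (Vote A)} {a x y : A} {v : Vote A}
    (hB : SeparatingVotes B a x y v) {R : ScoreRule A} {C : ℕ}
    (hR : ∀ (n : ℕ) (P : Profile A n) (a b : A),
      tidemanScore n P a + C < tidemanScore n P b → R n P a < R n P b)
    -- The bound `4 ≤ Fintype.card A` enters multiplied by `k`, so that `omega` can treat the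
    -- product as an atom.
    {q k n : ℕ} (hn : 20 * q + k = n) (hk : 4 * k ≤ Fintype.card A * k)
    (hq : Fintype.card A * k + C < q) (P : Profile A n)
    (hP : q • B ≤ (situation P : Multiset (Vote A))) :
    Disjoint (winners R P) (winners dodgsonScore P) := by
  have key : ∀ (c : ℕ) (p : Vote A → Prop) [DecidablePred p], c ≤ B.countP p →
      c * q ≤ (Finset.univ.filter fun i => p (P i)).card := by
    intro c p _ h
    rw [← countP_situation]
    refine le_trans ?_ (Multiset.countP_le_of_le p hP)
    rw [Multiset.countP_nsmul, mul_comm]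
    exact Nat.mul_le_mul_left q h
  have hax : 8 * q ≤ prefCount P a x := key _ _ hB.a_x
  have hxa : 12 * q ≤ prefCount P x a := key _ _ hB.x_a
  have hay : 13 * q ≤ prefCount P a y := key _ _ hB.a_y
  have hyx : 13 * q ≤ prefCount P y x := key _ _ hB.y_x
  have hxy : 7 * q ≤ prefCount P x y := key _ _ hB.x_y
  have haw : ∀ w, w ≠ a → w ≠ x → 10 * q ≤ prefCount P a w := fun w h h' => key _ _ (hB.a_w w h h')
  have hxw : ∀ w, w ≠ a → w ≠ x → w ≠ y → 20 * q ≤ prefCount P x w :=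
    fun w h h' h'' => key _ _ (hB.x_w w h h' h'')
  have hfar := key _ _ hB.far
  have hnear := key _ _ hB.near
  have hTa : tidemanScore n P a ≤ 4 * q + Fintype.card A * k := by
    have h : ∀ b ∈ Finset.univ.erase a, adv P b a ≤ (if b = x then 4 * q else 0) + k := by
      intro b hb
      have hba := Finset.ne_of_mem_erase hb
      have hs := prefCount_add_prefCount P hba
      rw [adv]
      split_ifs with h
      · subst h; omega
      · have := haw b hba h; omega
    rw [tidemanScore]
    refine (Finset.sum_le_sum h).trans ?_
    rw [Finset.sum_add_distrib, Finset.sum_ite_eq', Finset.sum_const, smul_eq_mul]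
    refine Nat.add_le_add ?_ (Nat.mul_le_mul_right k (Finset.card_le_univ _))
    split_ifs <;> omega
  have hadv : ∀ b c, b ≠ c → adv P b c ≤ tidemanScore n P c := fun b c h =>
    Finset.single_le_sum (f := fun b => adv P b c) (fun _ _ => Nat.zero_le _)
      (Finset.mem_erase.2 ⟨h, Finset.mem_univ b⟩)
  have hT : ∀ w, w ≠ a → 6 * q ≤ tidemanScore n P w + k := by
    intro w hwa
    rcases eq_or_ne w x with rfl | hwx
    · have := hadv y w hB.ne_xy.symm
      have := prefCount_add_prefCount P hB.ne_xy
      rw [adv] at *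
      omega
    · rcases eq_or_ne w y with rfl | hwy
      · have := hadv a w hB.ne_ay
        have := prefCount_add_prefCount P hB.ne_ay
        rw [adv] at *
        omega
      · have := hadv x w hwx.symm
        have := prefCount_add_prefCount P hwx
        have := hxw w hwa hwx hwy
        rw [adv] at *
        omega
  have hDa := two_mul_card_le_dodgsonScore_add P hB.ne_ax.symm
  have hDx : dodgsonScore n P x ≤ 3 * q + k := by
    refine dodgsonScore_le P v hB.adjacent _ (by omega) (by omega) fun w hwx hwy => ?_
    rcases eq_or_ne w a with rfl | hwa
    · omega
    · have := hxw w hwa hwx hwy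
      omega
  rw [Set.disjoint_left]
  intro w hw hw'
  -- Dodgson excludes `a`, as `3q + k < 4q - k`; the rule `R` excludes every other alternative, as
  -- their Tideman scores are at least `6q - k`.
  rcases eq_or_ne w a with rfl | hwa
  · have := hw' x
    omega
  · have h₁ := hw a
    have h₂ := hR n P a w (by have := hT w hwa; omega)
    omega

end Separation

/-! ### Counting voting situations under IAC -/

section Probability

variable {A : Type*} [Fintype A] [DecidableEq A]

/-- Given a situation in `F`, the event has conditional probability 1, so only the uniform law on
situations matters. -/
theorem card_div_card_le_iacProb {n : ℕ} (E : Set (Profile A n)) (F : Finset (Sym (Vote A) n))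
    (h : ∀ P, situation P ∈ F → P ∈ E) :
    (F.card : ENNReal) / Fintype.card (Sym (Vote A) n) ≤ iacProb n E := by
  rw [iacProb, iac, PMF.toOuterMeasure_bind_apply]
  refine le_trans (le_of_eq ?_) (ENNReal.sum_le_tsum F)
  rw [Finset.sum_congr rfl (g := fun _ => (Fintype.card (Sym (Vote A) n) : ENNReal)⁻¹),
    Finset.sum_const, nsmul_eq_mul, div_eq_mul_inv]
  intro U hU
  rw [PMF.uniformOfFintype_apply, (PMF.toOuterMeasure_apply_eq_one_iff _ _).2, mul_one]
  intro P hP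
  rw [PMF.mem_support_uniformOfFinset_iff, Finset.mem_filter] at hP
  exact h P (hP.2 ▸ hU)

theorem iacProb_add_le_one {n : ℕ} {E F : Set (Profile A n)} (h : Disjoint E F) :
    iacProb n E + iacProb n F ≤ 1 := by
  rw [iacProb, iacProb, PMF.toOuterMeasure_apply, PMF.toOuterMeasure_apply, ← ENNReal.tsum_add,
    ← (iac A n).tsum_coe]
  refine ENNReal.tsum_le_tsum fun P => ?_
  by_cases hE : P ∈ E
  · simp [hE, Set.disjoint_left.1 h hE]
  · simpa [hE] using Set.indicator_le_self _ _ P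

theorem ascFactorial_le_pow_mul {n k c : ℕ} (hc : 1 ≤ c) (h : n ≤ c * k) (d : ℕ) :
    (n + 1).ascFactorial d ≤ c ^ d * (k + 1).ascFactorial d := by
  induction d with
  | zero => simp
  | succ d ih =>
    rw [Nat.ascFactorial_succ, Nat.ascFactorial_succ]
    calc (n + 1 + d) * (n + 1).ascFactorial d
        ≤ (c * (k + 1 + d)) * (c ^ d * (k + 1).ascFactorial d) :=
          Nat.mul_le_mul (by nlinarith) ih
      _ = _ := by ring

/-- Up to the factor `d!`, both sides are rising factorials with `d` factors, compared one by one.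
-/
theorem multichoose_le_pow_mul {n k c : ℕ} (hc : 1 ≤ c) (h : n ≤ c * k) (d : ℕ) :
    (d + 1).multichoose n ≤ c ^ d * (d + 1).multichoose k := by
  have hm : ∀ j, d.factorial * (d + 1).multichoose j = (j + 1).ascFactorial d := by
    intro j
    rw [Nat.multichoose_eq, Nat.ascFactorial_eq_factorial_mul_choose,
      show d + 1 + j - 1 = j + d by omega, Nat.choose_symm_add]
  refine Nat.le_of_mul_le_mul_left ?_ (Nat.factorial_pos d)
  rw [Nat.mul_left_comm, hm, hm]
  exact ascFactorial_le_pow_mul hc h d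

/-- The situations with `n` votes that contain a given multiset of `n - k` votes form at least a
fraction `c ^ (1 - d)` of all, where `d` is the number of votes and `n ≤ c * k`. -/
theorem inv_pow_le_iacProb {n k c : ℕ} (hc : 1 ≤ c) (h : n ≤ c * k) (D : Multiset (Vote A))
    (hD : D.card + k = n) (E : Set (Profile A n))
    (hE : ∀ P : Profile A n, D ≤ (situation P : Multiset (Vote A)) → P ∈ E) :
    ((c : ENNReal) ^ (Fintype.card (Vote A) - 1))⁻¹ ≤ iacProb n E := by
  let f : Sym (Vote A) k → Sym (Vote A) n := fun U =>
    ⟨D + U, (Multiset.card_add D U).trans ((congrArg (D.card + ·) U.2).trans hD)⟩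
  have hf : Function.Injective f := fun U V hUV =>
    Subtype.ext (add_left_cancel (congrArg Subtype.val hUV))
  refine le_trans ?_ (card_div_card_le_iacProb E (Finset.univ.image f) fun P hP => hE P ?_)
  · rw [Finset.card_image_of_injective _ hf, Finset.card_univ, Sym.card_sym_eq_multichoose,
      Sym.card_sym_eq_multichoose]
    obtain ⟨d, hd⟩ := Nat.exists_eq_succ_of_ne_zero (Fintype.card_ne_zero (α := Vote A))
    rw [hd, Nat.succ_eq_add_one, Nat.add_sub_cancel]
    have hle := multichoose_le_pow_mul hc h d
    have hpos : (d + 1).multichoose n ≠ 0 := by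
      rw [Nat.multichoose_eq]
      exact (Nat.choose_pos (by omega)).ne'
    have hcpos : (c : ENNReal) ^ d ≠ 0 := pow_ne_zero _ (by simp; omega)
    rw [ENNReal.le_div_iff_mul_le (Or.inl (by exact_mod_cast hpos)) (Or.inl (by simp)), mul_comm,
      ← div_eq_mul_inv, ENNReal.div_le_iff_le_mul (Or.inl hcpos) (Or.inl (by simp)), mul_comm]
    exact_mod_cast hle
  · obtain ⟨U, -, hU⟩ := Finset.mem_image.1 hP
    rw [← hU]
    exact Multiset.le_add_right D U

/-- A rule that follows Tideman's rule has no winner in common with Dodgson's rule with a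
probability that is bounded away from zero. -/
theorem FollowsTideman.exists_le_iacProb_disjoint (hm : 4 ≤ Fintype.card A) {R : ScoreRule A}
    (hR : FollowsTideman R) :
    ∃ ε : ENNReal, 0 < ε ∧ ∀ᶠ n in Filter.atTop,
      ε ≤ iacProb n {P : Profile A n | Disjoint (winners R P) (winners dodgsonScore P)} := by
  obtain ⟨C, hC⟩ := hR
  obtain ⟨B, a, x, y, v, hB⟩ := exists_separatingVotes hm
  set m := Fintype.card A with hmdef
  -- With `n = M * j + r`, use `q = (m + 1) * j` copies of `B` and `k = j + r` free votes. Then `m *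
  -- k + C < q` amounts to `m * r + C < j`, which holds for large `n`, and `n ≤ 2 * M * k`.
  set M := 20 * (m + 1) + 1 with hM
  refine ⟨(((2 * M : ℕ) : ENNReal) ^ (Fintype.card (Vote A) - 1))⁻¹,
    ENNReal.inv_pos.2 (ENNReal.pow_ne_top (ENNReal.natCast_ne_top _)), ?_⟩
  filter_upwards [Filter.eventually_ge_atTop (M * (m * M + C + 1))] with n hn
  have hMpos : 0 < M := by omega
  obtain ⟨j, r, hr, hj, rfl⟩ : ∃ j r, r < M ∧ m * M + C + 1 ≤ j ∧ M * j + r = n :=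
    ⟨n / M, n % M, Nat.mod_lt _ hMpos, (Nat.le_div_iff_mul_le hMpos).2 (by linarith),
      Nat.div_add_mod n M⟩
  have hmr : m * r ≤ m * M := Nat.mul_le_mul_left m hr.le
  have hsum : 20 * ((m + 1) * j) + (j + r) = M * j + r := by rw [hM]; ring
  refine inv_pow_le_iacProb (k := j + r) (by omega) ?_ (((m + 1) * j) • B) ?_ _ fun P hP => ?_
  · nlinarith [Nat.mul_le_mul_left M (show 1 ≤ j by omega), Nat.zero_le (M * r)]
  · rw [Multiset.card_nsmul, hB.card_eq, ← hsum]
    ring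
  · refine hB.disjoint_winners hC hsum (Nat.mul_le_mul_right _ hm) ?_ P hP
    rw [← hmdef]
    nlinarith

end Probability

end Election

theorem mainTheorem4 {A : Type*} [Fintype A] [DecidableEq A] (hm : 4 ≤ Fintype.card A)
    (R : Election.ScoreRule A)
    (hR : R = Election.dqScore ∨ R = Election.tidemanScore ∨
      ∃ (strict : Bool) (p : ℕ), R = Election.greedyScore strict p) :
    ¬ Election.ConvergeUnderIAC R Election.dodgsonScore ∧
      ∃ ε : ENNReal, 0 < ε ∧ ∀ᶠ n in Filter.atTop,
        ε ≤ Election.iacProb n {P : Election.Profile A n |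
          Disjoint (Election.winners R P) (Election.winners Election.dodgsonScore P)} := by
  have hF : Election.FollowsTideman R := by
    rcases hR with rfl | rfl | ⟨strict, p, rfl⟩
    · exact Election.followsTideman_dqScore
    · exact Election.followsTideman_tidemanScore
    · exact Election.followsTideman_greedyScore strict p
  obtain ⟨ε, hε, hev⟩ := hF.exists_le_iacProb_disjoint hm
  refine ⟨fun hconv => ?_, ε, hε, hev⟩
  have : Nonempty A := Fintype.card_pos_iff.1 (by omega)
  have hle : ∀ᶠ n in Filter.atTop, Election.iacProb n {P : Election.Profile A n |
      Election.winners R P = Election.winners Election.dodgsonScore P} ≤ 1 - ε := by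
    filter_upwards [hev] with n hn
    -- Equal winner sets are nonempty and so cannot be disjoint; this caps the probability of
    -- agreement at `1 - ε`.
    have hdisj : Disjoint
        {P : Election.Profile A n |
          Election.winners R P = Election.winners Election.dodgsonScore P}
        {P : Election.Profile A n |
          Disjoint (Election.winners R P) (Election.winners Election.dodgsonScore P)} := by
      rw [Set.disjoint_left]
      intro P (h₁ : _ = _) (h₂ : Disjoint _ _)
      rw [h₁, disjoint_self] at h₂
      exact (Election.winners_nonempty Election.dodgsonScore P).ne_empty h₂
    have h := Election.iacProb_add_le_one hdisj
    have h' := (add_le_add_right hn _).trans h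
    refine ENNReal.le_sub_of_add_le_right (fun htop => ?_) h'
    rw [htop, add_top] at h'
    exact absurd h' (by simp)
  have h₁ : (1 : ENNReal) ≤ 1 - ε := le_of_tendsto hconv hle
  exact absurd h₁ (not_le.2 (ENNReal.sub_lt_self ENNReal.one_ne_top one_ne_zero hε.ne'))
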